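/- All graphs are finite and simple. For a graph $G$, let $\star(G)$ denote the maximum number of vertices of a connected component of $G$ (and $\star(G)=0$ if $G$ has no vertices). For a non-decreasing function $r\colon\mathbb{N}\to\mathbb{R}_{\ge 0}$, a class of graphs is fractionally $\star$-fragile at rate $r$ if for every graph $G$ in the class and every positive integer $a$, there exists a probability distribution on the sets $X\subseteq V(G)$ satisfying $\star(G-X)\le r(a)$ such that every vertex of $G$ belongs to the random set $X$ with probability at most $1/a$. There exists an absolute constant $C\ge 0$ such that for all positive integers $k$ and $\Delta$ with $\Delta\ge 3$, the class of graphs of treewidth less than $k$ and maximum degree at most $\Delta$ is fractionally $\star$-fragile at rate $$r(a)=k(\Delta-1)^{a+C\sqrt{a}}.$$ -/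

import Mathlib

universe u

namespace FracFragile

/-- A real-valued parameter of finite graphs: nonnegative and invariant under isomorphism. -/
structure GraphParameter where
  toFun : ∀ {V : Type u} [Finite V], SimpleGraph V → ℝ
  nonneg : ∀ {V : Type u} [Finite V] (G : SimpleGraph V), 0 ≤ toFun G
  iso_inv : ∀ {V W : Type u} [Finite V] [Finite W] (G : SimpleGraph V) (H : SimpleGraph W),
    Nonempty (G ≃g H) → toFun G = toFun H

/-- The maximum order of a connected component of a finite graph
(`0` for the graph without vertices). -/
noncomputable def maxComponentOrder {V : Type u} [Finite V] (G : SimpleGraph V) : ℕ :=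
  ⨆ c : G.ConnectedComponent, c.supp.ncard

theorem maxComponentOrder_iso {V W : Type u} [Finite V] [Finite W]
    (G : SimpleGraph V) (H : SimpleGraph W) (e : G ≃g H) :
    maxComponentOrder G = maxComponentOrder H := by
  unfold maxComponentOrder
  refine Equiv.iSup_congr e.connectedComponentEquiv fun c => ?_
  rw [← Nat.card_coe_set_eq, ← Nat.card_coe_set_eq]
  exact (Nat.card_congr (SimpleGraph.ConnectedComponent.isoEquivSupp e c)).symm

/-- The graph parameter `⋆`: the maximum order of a component. -/
noncomputable def star : GraphParameter.{u} where
  toFun G := (maxComponentOrder G : ℝ)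
  nonneg _ := Nat.cast_nonneg _
  iso_inv G H := fun ⟨e⟩ => by rw [maxComponentOrder_iso G H e]

/-- The sets `Y` of vertices such that `f (G - Y) ≤ b`. -/
def deletionSets (f : GraphParameter.{u}) {V : Type u} [Finite V] (G : SimpleGraph V) (b : ℝ) :
    Set (Set V) :=
  {Y | f.toFun (G.induce Yᶜ) ≤ b}

/-- A probability distribution on sets of vertices is `ε`-thin if each vertex belongs to the
sampled set with probability at most `ε`. -/
def IsThin {V : Type u} (p : PMF (Set V)) (ε : ℝ) : Prop :=
  ∀ v : V, p.toOuterMeasure {X | v ∈ X} ≤ ENNReal.ofReal ε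

/-- For every positive integer `a` there is a `(1/a)`-thin probability distribution supported on
the vertex sets whose deletion brings `f` down to at most `r a`. -/
def FragileAtRate (f : GraphParameter.{u}) {V : Type u} [Finite V] (G : SimpleGraph V)
    (r : ℕ → ℝ) : Prop :=
  ∀ a : ℕ, 1 ≤ a → ∃ p : PMF (Set V), p.support ⊆ deletionSets f G (r a) ∧ IsThin p (1 / (a : ℝ))

/-- A rate function is a nonnegative and non-decreasing function of a natural number. -/
structure IsRate (r : ℕ → ℝ) : Prop where
  nonneg : ∀ a, 0 ≤ r a
  mono : Monotone r

/-- A class of finite graphs. -/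
abbrev GraphClass := ∀ (V : Type u) [Fintype V], SimpleGraph V → Prop

/-- `r` is a rate function, and every graph of the class is fractionally `f`-fragile at rate `r`. -/
def GraphClass.FractionallyFragileAtRate (𝒢 : GraphClass.{u}) (f : GraphParameter.{u})
    (r : ℕ → ℝ) : Prop :=
  IsRate r ∧ ∀ (V : Type u) [Fintype V] (G : SimpleGraph V), 𝒢 V G → FragileAtRate f G r

/-- A tree decomposition of `G` over a finite tree. -/
structure TreeDecomposition {V : Type u} (G : SimpleGraph V) where
  Node : Type
  [fintypeNode : Fintype Node]
  tree : SimpleGraph Node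
  isTree : tree.IsTree
  bag : Node → Finset V
  /-- the ends of every edge lie in a common bag -/
  edge_mem : ∀ v w : V, G.Adj v w → ∃ t, v ∈ bag t ∧ w ∈ bag t
  /-- the nodes whose bags contain `v` induce a (nonempty, connected) subtree -/
  connected : ∀ v : V, (tree.induce {t | v ∈ bag t}).Connected

attribute [instance] TreeDecomposition.fintypeNode

/-- The maximum size of a bag, minus one. -/
def TreeDecomposition.width {V : Type u} {G : SimpleGraph V} (D : TreeDecomposition G) : ℕ :=
  (Finset.univ.sup fun t => (D.bag t).card) - 1

/-- The decomposition with a single bag; it shows that the infimum defining the treewidth of a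
finite graph is over a nonempty set. -/
def TreeDecomposition.trivial {V : Type u} [Fintype V] (G : SimpleGraph V) :
    TreeDecomposition G where
  Node := Unit
  tree := ⊥
  isTree := SimpleGraph.IsTree.of_subsingleton
  bag _ := Finset.univ
  edge_mem _ _ _ := ⟨(), Finset.mem_univ _, Finset.mem_univ _⟩
  connected v :=
    { preconnected := fun x y => by rw [Subsingleton.elim x y]
      nonempty := ⟨⟨(), Finset.mem_univ v⟩⟩ }

/-- The treewidth of a finite graph: the minimum width of a tree decomposition
(`0` for the graph without vertices). -/
noncomputable def treewidth {V : Type u} [Fintype V] (G : SimpleGraph V) : ℕ :=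
  sInf {w | ∃ D : TreeDecomposition G, D.width = w}

open Classical in
/-- The class of graphs of treewidth less than `k` and maximum degree at most `Δ`. -/
def boundedTreewidthDegree (k Δ : ℕ) : GraphClass.{u} :=
  fun _ _ G => treewidth G < k ∧ G.maxDegree ≤ Δ

end FracFragile

/-! Grow vertex sets `A 0 ⊆ A 1 ⊆ ...` in the manner of breadth-first search. `A 0` has one vertex
in each component of `G`, and each step adds the frontier together with a small set `Z j`. Neighbors
enter at most one step apart, so deleting the vertices whose entry time lies in a random residue
class modulo `a` confines each remaining component to fewer than `a` consecutive layers. Two facts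
bound such a component. Treewidth gives the start: `exists_split` chooses `Z j` so that each
component of `G - A (j + 1)` attaches to at most `(a + 2) * k` vertices, and hence begins with a
first layer of at most `(a + 2) * k * Δ` vertices. The degree gives the growth: a frontier vertex
already has a neighbor inside, so it contributes at most `Δ - 1` new ones, and since `Z j` is at
most a `1 / a` fraction of the frontier in every component, each step multiplies the frontier by at
most `(Δ - 1) * (1 + 2 / a)`. Over `a` steps the correction `(1 + 2 / a) ^ a` stays below `e ^ 2`;
the remaining factors, polynomial in `a` and linear in `Δ`, are absorbed by `(Δ - 1) ^ (12 * √a)`.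
-/

namespace FracFragile

open Finset

/-! ### Rooted tree decompositions and their branches -/

section Tree

/-- Every tree can be rooted: each edge joins a node to its parent, and parents are closer to the
root. -/
theorem exists_parent {N : Type*} {T : SimpleGraph N} (hT : T.IsTree) (root : N) :
    ∃ (parent : N → N) (depth : N → ℕ), parent root = root ∧
      (∀ t, t ≠ root → depth (parent t) < depth t) ∧
      (∀ t t', T.Adj t t' → parent t = t' ∨ parent t' = t) := by
  choose P hP using fun t => (hT.existsUnique_path root t).exists
  -- The path to the root is `nil`, whose penultimate node is the root itself.
  refine ⟨fun t => (P t).penultimate, T.dist root, ?_, fun t ht => ?_, fun t t' h => ?_⟩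
  · have : P root = .nil := (hT.existsUnique_path root root).unique (hP root) .nil
    simp [this]
  · obtain ⟨q, hq, hlen⟩ := hT.connected.exists_path_of_dist root t
    have hPq : P t = q := (hT.existsUnique_path root t).unique (hP t) hq
    have hnil : ¬ (P t).Nil := fun h => ht h.eq.symm
    have h1 := SimpleGraph.dist_le (P t).dropLast
    have h2 := SimpleGraph.Walk.not_nil_iff_lt_length.1 hnil
    have h3 : (P t).dropLast.length = (P t).length - 1 := by simp
    rw [← hPq] at hlen
    change T.dist root (P t).penultimate < _
    omega
  · by_cases hmem : t' ∈ (P t).support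
    · exact Or.inl (hT.isAcyclic.eq_penultimate_of_adj_end (hP t) h hmem).symm
    · have := hT.isAcyclic.mem_support_of_ne_mem_support_of_adj_of_isPath (hP t') (hP t) h.symm hmem
      exact Or.inr (hT.isAcyclic.eq_penultimate_of_adj_end (hP t') h.symm this).symm

theorem reachable_invariant {W : Type*} {H : SimpleGraph W} {x y : W} (h : H.Reachable x y)
    (p : W → Prop) (step : ∀ u v, H.Adj u v → p u → p v) (hx : p x) : p y := by
  obtain ⟨w⟩ := h
  induction w with
  | nil => exact hx
  | cons hadj _ ih => exact ih (step _ _ hadj hx)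

/-- The vertices in the bags of the subtrees of a rooted tree decomposition: `branch t` is the
union of the bags at and below `t`. -/
theorem TreeDecomposition.exists_branches {V : Type u} {G : SimpleGraph V}
    (D : TreeDecomposition G) :
    ∃ (root : D.Node) (parent : D.Node → D.Node) (depth : D.Node → ℕ) (branch : D.Node → Set V),
      (∀ v, v ∈ branch root) ∧ (∀ t, ∀ v ∈ D.bag t, v ∈ branch t) ∧
      (∀ t, ∀ v ∈ branch t, v ∉ D.bag t → ∃ c, parent c = t ∧ depth t < depth c ∧ v ∈ branch c) ∧
      (∀ c, branch c ⊆ branch (parent c)) ∧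
      (∀ c, ∀ v ∈ branch c, v ∉ D.bag (parent c) → ∀ w, G.Adj v w → w ∈ branch c) := by
  obtain ⟨root⟩ := D.isTree.connected.nonempty
  obtain ⟨parent, depth, hroot, hdepth, hedge⟩ := exists_parent D.isTree root
  let below : D.Node → D.Node → Prop := fun t s => ∃ n, parent^[n] s = t
  have below_root : ∀ s, below root s := by
    intro s
    induction hd : depth s using Nat.strong_induction_on generalizing s with
    | _ n ih =>
      by_cases hs : s = root
      · exact ⟨0, hs⟩
      · obtain ⟨m, hm⟩ := ih _ (hd ▸ hdepth s hs) (parent s) rfl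
        exact ⟨m + 1, hm⟩
  have below_parent : ∀ c s, below c s → below (parent c) s := by
    rintro c s ⟨n, rfl⟩
    exact ⟨n + 1, Function.iterate_succ_apply' ..⟩
  -- the only edge leaving the subtree at `c` leads from `c` to its parent
  have cross : ∀ c s s', D.tree.Adj s s' → below c s → ¬ below c s' → s' = parent c := by
    rintro c s s' hadj ⟨n, hn⟩ hs'
    rcases hedge s s' hadj with h | h
    · cases n with
      | zero => rw [← h, ← hn]; rfl
      | succ n => exact absurd ⟨n, by rw [← h]; exact hn⟩ hs'
    · exact absurd ⟨n + 1, by rw [Function.iterate_succ_apply, h]; exact hn⟩ hs'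
  have separate : ∀ c s s' v, v ∈ D.bag s → v ∈ D.bag s' → below c s → ¬ below c s' →
      v ∈ D.bag (parent c) := by
    intro c s s' v hs hs' hb hb'
    -- The nodes whose bags contain `v` are connected, so some edge between them leaves the subtree
    -- at `c`, and its outer end is `parent c`.
    by_contra hv
    refine hb' (reachable_invariant ((D.connected v).preconnected ⟨s, hs⟩ ⟨s', hs'⟩)
      (fun t => below c t.1) ?_ hb)
    rintro ⟨x, hx⟩ ⟨y, hy⟩ hadj hbx
    by_contra hby
    have : y = parent c := cross c x y hadj hbx hby
    exact hv (this ▸ hy)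
  refine ⟨root, parent, depth, fun t => {v | ∃ s, below t s ∧ v ∈ D.bag s}, ?_, ?_, ?_, ?_, ?_⟩
  · intro v
    obtain ⟨⟨s, hs⟩⟩ := (D.connected v).nonempty
    exact ⟨s, below_root s, hs⟩
  · exact fun t v hv => ⟨t, ⟨0, rfl⟩, hv⟩
  · rintro t v ⟨s, ⟨n, hn⟩, hv⟩ hvt
    have hst : s ≠ t := fun h => hvt (h ▸ hv)
    -- The child sought is the last node before `t` on the way up from `s`. Taking the first arrival
    -- at `t` keeps it different from `t`, hence from the root, where `parent` is stationary.
    have hfind : ∃ n, parent^[n] s = t := ⟨n, hn⟩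
    classical
    have hpos : Nat.find hfind ≠ 0 := fun h0 => hst (by
      have := Nat.find_spec hfind
      rwa [h0] at this)
    obtain ⟨m, hm⟩ := Nat.exists_eq_succ_of_ne_zero hpos
    have hspec : parent^[m + 1] s = t := by
      have := Nat.find_spec hfind
      rwa [hm] at this
    rw [Function.iterate_succ_apply'] at hspec
    have hmin : parent^[m] s ≠ t := Nat.find_min hfind (by omega)
    have hne : parent^[m] s ≠ root := fun h => hmin (by rw [← hspec, h, hroot])
    refine ⟨parent^[m] s, hspec, ?_, s, ⟨m, rfl⟩, hv⟩
    have := hdepth _ hne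
    rwa [hspec] at this
  · rintro c v ⟨s, hs, hv⟩
    exact ⟨s, below_parent c s hs, hv⟩
  · rintro c v ⟨s, hs, hv⟩ hvc w hadj
    obtain ⟨j, hjv, hjw⟩ := D.edge_mem v w hadj
    by_cases hj : below c j
    · exact ⟨j, hj, hjw⟩
    · exact absurd (separate c s j v hv hjv hs hj) hvc

end Tree

/-! ### Bounding attachments by a sparse set of added vertices -/

section Split

/-- The graph formed by the edges of `G` with both ends in `B`. -/
def within {V : Type u} (G : SimpleGraph V) (B : Set V) : SimpleGraph V where
  Adj u v := G.Adj u v ∧ u ∈ B ∧ v ∈ B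
  symm := ⟨fun _ _ h => ⟨h.1.symm, h.2.2, h.2.1⟩⟩
  loopless := ⟨fun _ h => h.1.ne rfl⟩

theorem mem_of_within_reachable {V : Type u} {G : SimpleGraph V} {B : Set V} {x y : V}
    (h : (within G B).Reachable x y) (hx : x ∈ B) : y ∈ B :=
  reachable_invariant h (· ∈ B) (fun _ _ h _ => h.2.2) hx

open Classical in
/-- The vertices of `P` adjacent to the component of `x` in the subgraph of `G` induced by `B`. -/
noncomputable def attachment {V : Type u} [Fintype V] (G : SimpleGraph V) (B : Set V)
    (P : Finset V) (x : V) : Finset V :=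
  P.filter fun p => ∃ v, (within G B).Reachable x v ∧ G.Adj v p

theorem mem_attachment {V : Type u} [Fintype V] {G : SimpleGraph V} {B : Set V}
    {P : Finset V} {x p : V} :
    p ∈ attachment G B P x ↔ p ∈ P ∧ ∃ v, (within G B).Reachable x v ∧ G.Adj v p := by
  simp [attachment]

open Classical in
/-- A set `S` of vertices of a graph of small treewidth can be slightly enlarged so that the
components of the rest have bounded attachments. -/
theorem TreeDecomposition.exists_split {V : Type u} [Fintype V] {G : SimpleGraph V}
    (D : TreeDecomposition G) {k a : ℕ} (hk : 1 ≤ k) (ha : 1 ≤ a)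
    (hbag : ∀ t, (D.bag t).card ≤ k) (K S : Finset V) (hSK : S ⊆ K) :
    ∃ Z ⊆ K, a * Z.card ≤ S.card ∧ ∀ x ∈ K \ (S ∪ Z),
      (attachment G ↑(K \ (S ∪ Z)) (S ∪ Z) x).card ≤ (a + 2) * k := by
  obtain ⟨root, parent, depth, branch, hroot, hbb, hchild, hsub, hclosed⟩ := D.exists_branches
  induction hn : S.card using Nat.strong_induction_on generalizing K S with
  | _ n ih =>
  by_cases hsmall : S.card < (a + 1) * k
  · refine ⟨∅, by simp, by simp, fun x _ => ?_⟩
    calc _ ≤ (S ∪ ∅).card := card_le_card (filter_subset _ _)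
      _ ≤ _ := by rw [union_empty]; nlinarith
  -- Cut at a deepest node whose branch is rich in `S`: the branches of its children then hold fewer
  -- than `(a + 1) * k` vertices of `S`, and the bag at `t` adds at most `k`.
  obtain ⟨t, ht, hmax⟩ := exists_max_image
    (univ.filter fun t => (a + 1) * k ≤ (S.filter (· ∈ branch t)).card) depth
    ⟨root, by simpa [hroot] using hsmall⟩
  rw [mem_filter] at ht
  have hclosed' : ∀ v ∈ branch t, v ∉ D.bag t → ∀ w, G.Adj v w → w ∈ branch t := by
    intro v hv hvt w hadj
    obtain ⟨c, rfl, -, hvc⟩ := hchild t v hv hvt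
    exact hsub c (hclosed c v hvc hvt w hadj)
  let cut : V → Prop := fun v => v ∈ branch t ∧ v ∉ D.bag t
  let K' := K.filter (¬ cut ·)
  let S' := S.filter (· ∉ branch t) ∪ (D.bag t ∩ K)
  -- At least `(a + 1) * k` vertices of `S` are traded for at most `k` vertices of the bag. The loss
  -- of `a * k` pays for putting the bag into `Z`.
  have hcard : S'.card + a * k ≤ S.card := by
    have h1 : S'.card ≤ (S.filter (· ∉ branch t)).card + k :=
      (card_union_le _ _).trans
        (Nat.add_le_add_left ((card_le_card inter_subset_left).trans (hbag t)) _)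
    have h2 := card_filter_add_card_filter_not (s := S) (· ∈ branch t)
    have h3 := ht.2
    have : (a + 1) * k = a * k + k := by ring
    omega
  have hS'K' : S' ⊆ K' := by
    intro v hv
    simp only [S', K', cut, mem_union, mem_filter, mem_inter] at hv ⊢
    rcases hv with hv | hv
    · exact ⟨hSK hv.1, fun h => hv.2 h.1⟩
    · exact ⟨hv.2, fun h => h.2 hv.1⟩
  have hak : 1 ≤ a * k := Nat.mul_pos ha hk
  obtain ⟨Z', hZ'K', hZ'card, hZ'⟩ := ih S'.card (by omega) K' S' hS'K' rfl
  have hK'K : K' ⊆ K := filter_subset _ _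
  refine ⟨Z' ∪ (D.bag t ∩ K), union_subset (hZ'K'.trans hK'K) inter_subset_right, ?_, ?_⟩
  · have h1 : (Z' ∪ (D.bag t ∩ K)).card ≤ Z'.card + k :=
      (card_union_le _ _).trans
        (Nat.add_le_add_left ((card_le_card inter_subset_left).trans (hbag t)) _)
    calc a * _ ≤ a * (Z'.card + k) := Nat.mul_le_mul_left _ h1
      _ = a * Z'.card + a * k := by ring
      _ ≤ n := by omega
  intro x hx
  set P := S ∪ (Z' ∪ (D.bag t ∩ K)) with hP
  have hbagP : ∀ v ∈ D.bag t, v ∉ K \ P := by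
    intro v hv hvK
    simp only [hP, mem_sdiff, mem_union, mem_inter] at hvK
    exact hvK.2 (Or.inr (Or.inr ⟨hv, hvK.1⟩))
  by_cases hxt : x ∈ branch t
  · -- the component of `x` lies in the branch of a child of `t`
    obtain ⟨c, rfl, hdc, hxc⟩ := hchild t x hxt fun h => hbagP x h hx
    have hcsmall : (S.filter (· ∈ branch c)).card < (a + 1) * k := by
      by_contra hc
      exact absurd (hmax c (by simpa using hc)) (by omega)
    have hreach : ∀ y, (within G ↑(K \ P)).Reachable x y → y ∈ branch c := fun y hy =>
      reachable_invariant hy (· ∈ branch c)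
        (fun u v huv hu => hclosed c u hu (fun h => hbagP u h huv.2.1) v huv.1) hxc
    have hattach : attachment G ↑(K \ P) P x ⊆ S.filter (· ∈ branch c) ∪ D.bag (parent c) := by
      intro p hp
      obtain ⟨hpP, y, hy, hadj⟩ := mem_attachment.1 hp
      have hyK := mem_of_within_reachable hy hx
      have hpc : p ∈ branch c := hclosed c y (hreach y hy) (fun h => hbagP y h hyK) p hadj
      simp only [hP, mem_union, mem_inter] at hpP
      rw [mem_union, mem_filter]
      rcases hpP with hpS | hpZ | hpb
      · exact Or.inl ⟨hpS, hpc⟩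
      · have := (mem_filter.1 (hZ'K' hpZ)).2
        by_contra hcon
        exact this ⟨hsub c hpc, fun h => hcon (Or.inr h)⟩
      · exact Or.inr hpb.1
    have h1 := (card_le_card hattach).trans (card_union_le _ _)
    have h2 := hbag (parent c)
    have : (a + 2) * k = (a + 1) * k + k := by ring
    omega
  · -- the component of `x` avoids the branch of `t`
    have hsubset : ∀ y ∈ K \ P, y ∉ branch t → y ∈ K' \ (S' ∪ Z') := by
      intro y hy hyt
      simp only [hP, S', K', cut, mem_sdiff, mem_union, mem_inter, mem_filter] at hy ⊢
      tauto
    have hstep : ∀ u v, (within G ↑(K \ P)).Adj u v → u ∉ branch t → v ∉ branch t :=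
      fun u v huv hu hv => hu (hclosed' v hv (fun h => hbagP v h huv.2.2) u huv.1.symm)
    have hreach : ∀ y, (within G ↑(K \ P)).Reachable x y →
        (within G ↑(K' \ (S' ∪ Z'))).Reachable x y ∧ y ∉ branch t := fun y hy =>
      reachable_invariant hy
        (fun y => (within G ↑(K' \ (S' ∪ Z'))).Reachable x y ∧ y ∉ branch t)
        (fun u v huv hu => ⟨hu.1.trans (SimpleGraph.Adj.reachable
          (show (within G ↑(K' \ (S' ∪ Z'))).Adj u v from
            ⟨huv.1, hsubset u huv.2.1 hu.2, hsubset v huv.2.2 (hstep u v huv hu.2)⟩)),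
          hstep u v huv hu.2⟩) ⟨.refl _, hxt⟩
    refine (card_le_card ?_).trans (hZ' x (hsubset x hx hxt))
    intro p hp
    obtain ⟨hpP, y, hy, hadj⟩ := mem_attachment.1 hp
    obtain ⟨hy', hyt⟩ := hreach y hy
    refine mem_attachment.2 ⟨?_, y, hy', hadj⟩
    have hpt : p ∈ branch t → p ∈ D.bag t := fun h => by
      by_contra hpb
      exact hyt (hclosed' p h hpb y hadj.symm)
    simp only [hP, S', mem_union, mem_inter, mem_filter] at hpP ⊢
    by_cases hpb : p ∈ branch t
    · have := hpt hpb
      rcases hpP with h | h | h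
      · exact Or.inl (Or.inr ⟨this, hSK h⟩)
      · exact Or.inr h
      · exact Or.inl (Or.inr h)
    · tauto

end Split

/-! ### Layerings and their growth -/

section Layers

variable {V : Type u} [Fintype V] {G : SimpleGraph V}

open Classical in
/-- The vertices outside `A` with a neighbor in `A`. -/
noncomputable def frontier (G : SimpleGraph V) (A : Finset V) : Finset V :=
  univ.filter fun v => v ∉ A ∧ ∃ u ∈ A, G.Adj u v

theorem mem_frontier {A : Finset V} {v : V} :
    v ∈ frontier G A ↔ v ∉ A ∧ ∃ u ∈ A, G.Adj u v := by
  simp [frontier]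

/-- `K` is a union of components of `G - A`. -/
structure IsClosedOff (G : SimpleGraph V) (A K : Finset V) : Prop where
  notMem : ∀ v ∈ K, v ∉ A
  mem_of_adj : ∀ u ∈ K, ∀ v, v ∉ A → G.Adj u v → v ∈ K

open Classical in
/-- `Z` completes `A` and its frontier to a set such that the components of the rest have at most
`s` attachments, and `Z` is sparse with respect to the frontier in each component of `G - A`. -/
structure IsCompletion (G : SimpleGraph V) (a s : ℕ) (A Z : Finset V) : Prop where
  attachment_le : ∀ x, x ∉ A ∪ frontier G A ∪ Z →
    (attachment G (↑(A ∪ frontier G A ∪ Z))ᶜ (A ∪ frontier G A ∪ Z) x).card ≤ s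
  sparse : ∀ K, IsClosedOff G A K → a * (Z ∩ K).card ≤ (frontier G A ∩ K).card

-- Each component of `G - A` is split separately, with its part of the frontier as `S`. Sparsity
-- then adds up over any union of components.
open Classical in
theorem TreeDecomposition.exists_isCompletion (D : TreeDecomposition G) {k a : ℕ} (hk : 1 ≤ k)
    (ha : 1 ≤ a) (hbag : ∀ t, (D.bag t).card ≤ k) (A : Finset V) :
    ∃ Z, IsCompletion G a ((a + 2) * k) A Z := by
  let H := within G (↑A)ᶜ
  let K : H.ConnectedComponent → Finset V := fun c =>
    univ.filter fun v => v ∉ A ∧ H.connectedComponentMk v = c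
  choose Z hZK hZcard hZ using fun c =>
    D.exists_split hk ha hbag (K c) (frontier G A ∩ K c) inter_subset_right
  have memK : ∀ c v, v ∈ K c ↔ v ∉ A ∧ H.connectedComponentMk v = c := by simp [K]
  have mk_eq : ∀ u v, G.Adj u v → u ∉ A → v ∉ A →
      H.connectedComponentMk u = H.connectedComponentMk v := fun u v h hu hv =>
    SimpleGraph.ConnectedComponent.sound (SimpleGraph.Adj.reachable (show H.Adj u v from
      ⟨h, by simpa using hu, by simpa using hv⟩))
  have memZ : ∀ v, v ∈ univ.biUnion Z ↔ v ∈ Z (H.connectedComponentMk v) := by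
    intro v
    simp only [mem_biUnion, mem_univ, true_and]
    refine ⟨fun ⟨c, hc⟩ => ?_, fun h => ⟨_, h⟩⟩
    rwa [((memK c v).1 (hZK c hc)).2]
  refine ⟨univ.biUnion Z, fun x hx => ?_, fun L hL => ?_⟩
  · set P := A ∪ frontier G A ∪ univ.biUnion Z with hP
    set c := H.connectedComponentMk x with hc
    have inside : ∀ y, y ∉ P → H.connectedComponentMk y = c →
        y ∈ K c \ (frontier G A ∩ K c ∪ Z c) := by
      intro y hy hyc
      simp only [hP, mem_union, memZ, not_or, hyc] at hy
      simp only [mem_sdiff, mem_union, mem_inter, memK]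
      tauto
    have hreach : ∀ y, (within G (↑P)ᶜ).Reachable x y →
        (within G ↑(K c \ (frontier G A ∩ K c ∪ Z c))).Reachable x y ∧ y ∉ P ∧
          H.connectedComponentMk y = c := fun y hy =>
      reachable_invariant hy (fun y => (within G ↑(K c \ (frontier G A ∩ K c ∪ Z c))).Reachable x y ∧
        y ∉ P ∧ H.connectedComponentMk y = c) (fun u v huv hu => by
          have hv : v ∉ P := by simpa using huv.2.2
          have hvA : v ∉ A := fun h => hv (by simp [hP, h])
          have huA : u ∉ A := fun h => hu.2.1 (by simp [hP, h])
          have hvc : H.connectedComponentMk v = c := by rw [← mk_eq u v huv.1 huA hvA, hu.2.2]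
          exact ⟨hu.1.trans (SimpleGraph.Adj.reachable
            (show (within G ↑(K c \ (frontier G A ∩ K c ∪ Z c))).Adj u v from
              ⟨huv.1, inside u hu.2.1 hu.2.2, inside v hv hvc⟩)), hv, hvc⟩) ⟨.refl _, hx, rfl⟩
    refine (card_le_card fun p hp => ?_).trans (hZ c x (inside x hx rfl))
    obtain ⟨hpP, y, hy, hadj⟩ := mem_attachment.1 hp
    obtain ⟨hy', hyP, hyc⟩ := hreach y hy
    refine mem_attachment.2 ⟨?_, y, hy', hadj⟩
    have hyA : y ∉ A := fun h => hyP (by simp [hP, h])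
    have hyF : y ∉ frontier G A := fun h => hyP (by simp [hP, h])
    -- Since `y` lies outside the frontier, none of its neighbors is in `A`; older vertices of `A`
    -- are never attachments.
    have hpA : p ∉ A := fun h => hyF (mem_frontier.2 ⟨hyA, p, h, hadj.symm⟩)
    have hpc : H.connectedComponentMk p = c := by rw [← mk_eq y p hadj hyA hpA, hyc]
    simp only [hP, mem_union, memZ, hpc] at hpP
    simp only [mem_union, mem_inter, memK]
    tauto
  · let I := L.image H.connectedComponentMk
    have hKL : ∀ c ∈ I, K c ⊆ L := by
      intro c hc v hv
      obtain ⟨x, hxL, rfl⟩ := mem_image.1 hc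
      exact reachable_invariant (SimpleGraph.ConnectedComponent.exact ((memK _ v).1 hv).2.symm)
        (· ∈ L) (fun u v huv hu => hL.mem_of_adj u hu v (by simpa using huv.2.2) huv.1) hxL
    have h1 : univ.biUnion Z ∩ L ⊆ I.biUnion Z := by
      intro v hv
      rw [mem_inter, memZ] at hv
      exact mem_biUnion.2 ⟨_, mem_image_of_mem _ hv.2, hv.1⟩
    calc a * (univ.biUnion Z ∩ L).card ≤ a * ∑ c ∈ I, (Z c).card :=
          Nat.mul_le_mul_left _ ((card_le_card h1).trans card_biUnion_le)
      _ = ∑ c ∈ I, a * (Z c).card := mul_sum ..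
      _ ≤ ∑ c ∈ I, (frontier G A ∩ K c).card := sum_le_sum fun c _ => hZcard c
      _ ≤ ∑ c ∈ I, ((frontier G A ∩ L).filter (H.connectedComponentMk · = c)).card := by
          refine sum_le_sum fun c hc => card_le_card fun v hv => ?_
          rw [mem_inter] at hv
          exact mem_filter.2 ⟨mem_inter.2 ⟨hv.1, hKL c hc hv.2⟩, ((memK c v).1 hv.2).2⟩
      _ = (frontier G A ∩ L).card :=
          (card_eq_sum_card_fiberwise fun v hv => by
            exact mem_image_of_mem _ (mem_inter.1 hv).2).symm

open Classical in
/-- An increasing sequence of vertex sets, each obtained from the previous one by adding its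
frontier and a sparse set. -/
structure IsLayering (G : SimpleGraph V) (a s : ℕ) (A Z : ℕ → Finset V) : Prop where
  seed : ∀ x, ∃! v, v ∈ A 0 ∧ G.Reachable x v
  succ : ∀ j, A (j + 1) = A j ∪ frontier G (A j) ∪ Z j
  completion : ∀ j, IsCompletion G a s (A j) (Z j)

open Classical in
theorem TreeDecomposition.exists_isLayering (D : TreeDecomposition G) {k a : ℕ} (hk : 1 ≤ k)
    (ha : 1 ≤ a) (hbag : ∀ t, (D.bag t).card ≤ k) :
    ∃ A Z : ℕ → Finset V, IsLayering G a ((a + 2) * k) A Z := by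
  choose z hz using D.exists_isCompletion hk ha hbag
  let A : ℕ → Finset V := fun n => Nat.rec (univ.image fun c : G.ConnectedComponent => c.out)
    (fun _ B => B ∪ frontier G B ∪ z B) n
  refine ⟨A, fun j => z (A j), fun x => ⟨(G.connectedComponentMk x).out, ⟨?_, ?_⟩, ?_⟩,
    fun j => rfl, fun j => hz _⟩
  · exact mem_image_of_mem _ (mem_univ _)
  · exact SimpleGraph.ConnectedComponent.exact (Quot.out_eq (G.connectedComponentMk x)).symm
  · rintro y ⟨hy, hxy⟩
    obtain ⟨c, -, rfl⟩ := mem_image.1 hy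
    have : G.connectedComponentMk x = c :=
      (SimpleGraph.ConnectedComponent.sound hxy).trans (Quot.out_eq c)
    rw [this]

namespace IsLayering

variable {a s : ℕ} {A Z : ℕ → Finset V} (h : IsLayering G a s A Z)
include h

theorem subset_succ (j : ℕ) : A j ⊆ A (j + 1) := by
  intro v hv
  rw [h.succ]
  simp [hv]

theorem mono : Monotone A := monotone_nat_of_le_succ h.subset_succ

theorem mem_succ_of_adj {j : ℕ} {u v : V} (hu : u ∈ A j) (hadj : G.Adj u v) : v ∈ A (j + 1) := by
  by_cases hv : v ∈ A j
  · exact h.subset_succ j hv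
  · rw [h.succ]
    simp [mem_frontier.2 ⟨hv, u, hu, hadj⟩]

theorem exists_mem (v : V) : ∃ j, v ∈ A j := by
  obtain ⟨x, ⟨hx, hvx⟩, -⟩ := h.seed v
  exact reachable_invariant hvx.symm (fun v => ∃ j, v ∈ A j)
    (fun u w huw ⟨j, hj⟩ => ⟨j + 1, h.mem_succ_of_adj hj huw⟩) ⟨0, hx⟩

/-- `A 0` is not produced by a completion, but it meets each component of `G` in a single vertex. -/
theorem attachment_le (hs : 1 ≤ s) (j : ℕ) (x : V) (hx : x ∉ A j) :
    (attachment G (↑(A j))ᶜ (A j) x).card ≤ s := by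
  cases j with
  | zero =>
    refine le_trans (card_le_one.2 fun p hp q hq => ?_) hs
    have key : ∀ p ∈ attachment G (↑(A 0))ᶜ (A 0) x, p ∈ A 0 ∧ G.Reachable x p := by
      intro p hp
      obtain ⟨hpA, y, hy, hadj⟩ := mem_attachment.1 hp
      refine ⟨hpA, SimpleGraph.Reachable.trans ?_ hadj.reachable⟩
      exact hy.mono (show within G _ ≤ G from fun _ _ h => h.1)
    exact (h.seed x).unique (key p hp) (key q hq)
  | succ j =>
    rw [h.succ] at hx ⊢
    exact (h.completion j).attachment_le x hx

end IsLayering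

open Classical in
theorem card_frontier_inter_le {Δ : ℕ} (hΔ : ∀ v, (univ.filter (G.Adj v)).card ≤ Δ)
    {A K N : Finset V} (hN : ∀ v ∈ K, ∀ u ∈ A, G.Adj v u → u ∈ N) :
    (frontier G A ∩ K).card ≤ N.card * Δ := by
  refine le_trans (card_le_card (t := N.biUnion fun u => univ.filter (G.Adj u)) fun v hv => ?_)
    (card_biUnion_le_card_mul _ _ _ fun u _ => hΔ u)
  obtain ⟨hvF, hvK⟩ := mem_inter.1 hv
  obtain ⟨-, u, hu, hadj⟩ := mem_frontier.1 hvF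
  exact mem_biUnion.2 ⟨u, hN v hvK u hu hadj.symm, by simpa using hadj⟩

open Classical in
theorem IsCompletion.frontier_le {a s Δ : ℕ} (hΔ2 : 2 ≤ Δ)
    (hΔ : ∀ v, (univ.filter (G.Adj v)).card ≤ Δ) {A Z K : Finset V} (h : IsCompletion G a s A Z)
    (hK : IsClosedOff G A K) :
    a * (frontier G (A ∪ frontier G A ∪ Z) ∩ K).card ≤
      (Δ - 1) * (a + 2) * (frontier G A ∩ K).card := by
  set P := A ∪ frontier G A ∪ Z with hP
  have hsub : frontier G P ∩ K ⊆
      ((frontier G A ∩ K).biUnion fun u => univ.filter fun v => G.Adj u v ∧ v ∉ A) ∪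
      ((Z ∩ K).biUnion fun u => univ.filter (G.Adj u)) := by
    intro v hv
    obtain ⟨hvF, hvK⟩ := mem_inter.1 hv
    obtain ⟨hvP, u, hu, hadj⟩ := mem_frontier.1 hvF
    have hvA : v ∉ A := hK.notMem v hvK
    have huA : u ∉ A := fun huA => hvP (by simp [hP, mem_frontier.2 ⟨hvA, u, huA, hadj⟩])
    have huK : u ∈ K := hK.mem_of_adj v hvK u huA hadj.symm
    simp only [hP, mem_union, huA, false_or] at hu
    rw [mem_union, mem_biUnion, mem_biUnion]
    rcases hu with hu | hu
    · exact Or.inl ⟨u, mem_inter.2 ⟨hu, huK⟩, by simp [hadj, hvA]⟩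
    · exact Or.inr ⟨u, mem_inter.2 ⟨hu, huK⟩, by simp [hadj]⟩
  have h1 : ∀ u ∈ frontier G A ∩ K,
      (univ.filter fun v => G.Adj u v ∧ v ∉ A).card ≤ Δ - 1 := by
    intro u hu
    obtain ⟨-, w, hw, hadj⟩ := mem_frontier.1 (mem_inter.1 hu).1
    refine Nat.le_sub_one_of_lt (lt_of_lt_of_le (card_lt_card ?_) (hΔ u))
    refine ⟨fun v => by simp +contextual, fun hcon => ?_⟩
    have := hcon (show w ∈ univ.filter (G.Adj u) by simpa using hadj.symm)
    simp [hw] at this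
  have h2 := (card_le_card hsub).trans ((card_union_le _ _).trans (Nat.add_le_add
    (card_biUnion_le_card_mul _ _ _ h1) (card_biUnion_le_card_mul _ _ _ fun u _ => hΔ u)))
  have h3 := h.sparse K hK
  -- A vertex of `Z` may contribute all `Δ` neighbors; `Δ ≤ 2 * (Δ - 1)` turns this into the `2` of
  -- `a + 2`.
  obtain ⟨d, rfl⟩ : ∃ d, Δ = d + 2 := ⟨Δ - 2, by omega⟩
  simp only [show d + 2 - 1 = d + 1 by omega] at h2 ⊢
  calc _ ≤ a * ((frontier G A ∩ K).card * (d + 1) + (Z ∩ K).card * (d + 2)) :=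
        Nat.mul_le_mul_left _ h2
    _ = a * (frontier G A ∩ K).card * (d + 1) + a * (Z ∩ K).card * (d + 2) := by ring
    _ ≤ a * (frontier G A ∩ K).card * (d + 1) + (frontier G A ∩ K).card * (2 * (d + 1)) := by
        gcongr
        omega
    _ = _ := by ring

open Classical in
/-- Growth of a layering inside a union of components of `G - A q`. -/
theorem IsLayering.card_inter_le {a s Δ : ℕ} {A Z : ℕ → Finset V} (h : IsLayering G a s A Z)
    (ha : 1 ≤ a) (hΔ2 : 2 ≤ Δ) (hΔ : ∀ v, (univ.filter (G.Adj v)).card ≤ Δ) (m q : ℕ)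
    (K : Finset V) (hK : IsClosedOff G (A q) K) :
    ((K ∩ A (q + m)).card : ℝ) ≤
      2 * m * (((Δ : ℝ) - 1) * (1 + 2 / a)) ^ m * (frontier G (A q) ∩ K).card := by
  have ha' : (1 : ℝ) ≤ a := by exact_mod_cast ha
  have hΔ' : (2 : ℝ) ≤ Δ := by exact_mod_cast hΔ2
  set ρ : ℝ := ((Δ : ℝ) - 1) * (1 + 2 / a) with hρ
  have hρ1 : 1 ≤ ρ := by
    have : (0 : ℝ) ≤ 2 / a := by positivity
    nlinarith
  induction m generalizing q K with
  | zero =>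
    have : K ∩ A q = ∅ := by
      ext v
      simpa using hK.notMem v
    simp [this]
  | succ m ih =>
    have hK' : IsClosedOff G (A (q + 1)) (K \ A (q + 1)) := by
      refine ⟨fun v hv => (mem_sdiff.1 hv).2, fun u hu v hv hadj => mem_sdiff.2 ⟨?_, hv⟩⟩
      exact hK.mem_of_adj u (mem_sdiff.1 hu).1 v (fun hvq => hv (h.subset_succ q hvq)) hadj
    -- The next layer has at most `2 * e` vertices, the frontier and the sparse set; the rest is
    -- closed off from `A (q + 1)`, so induction applies to it.
    have hsplit : K ∩ A (q + (m + 1)) ⊆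
        ((frontier G (A q) ∩ K) ∪ (Z q ∩ K)) ∪ ((K \ A (q + 1)) ∩ A (q + 1 + m)) := by
      intro v hv
      obtain ⟨hvK, hvA⟩ := mem_inter.1 hv
      have hvq := hK.notMem v hvK
      rw [show q + (m + 1) = q + 1 + m by ring] at hvA
      by_cases hv1 : v ∈ A (q + 1)
      · rw [h.succ] at hv1
        simp only [mem_union, mem_inter] at hv1 ⊢
        tauto
      · simp [hvK, hvA, hv1]
    have hc1 := (card_le_card hsplit).trans ((card_union_le _ _).trans
      (Nat.add_le_add_right (card_union_le _ _) _))
    have hsp := (h.completion q).sparse K hK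
    have hc2 : (Z q ∩ K).card ≤ (frontier G (A q) ∩ K).card :=
      le_trans (Nat.le_mul_of_pos_left _ ha) hsp
    have hE := (h.completion q).frontier_le hΔ2 hΔ hK
    rw [← h.succ] at hE
    have hEq : frontier G (A (q + 1)) ∩ (K \ A (q + 1)) = frontier G (A (q + 1)) ∩ K := by
      ext v
      simp only [mem_inter, mem_sdiff]
      exact ⟨fun hv => ⟨hv.1, hv.2.1⟩, fun hv => ⟨hv.1, hv.2, (mem_frontier.1 hv.1).1⟩⟩
    have hih := ih (q + 1) _ hK'
    rw [hEq] at hih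
    set e := (frontier G (A q) ∩ K).card
    set e' := (frontier G (A (q + 1)) ∩ K).card
    have hE' : (e' : ℝ) ≤ ρ * e := by
      have hcast : (a : ℝ) * e' ≤ ((Δ : ℝ) - 1) * (a + 2) * e := by
        have : ((Δ - 1 : ℕ) : ℝ) = (Δ : ℝ) - 1 := by
          rw [Nat.cast_sub (by omega), Nat.cast_one]
        rw [← this]
        exact_mod_cast hE
      have : ρ * e = ((Δ : ℝ) - 1) * (a + 2) * e / a := by
        rw [hρ]
        field_simp
      rw [this, le_div_iff₀ (by linarith)]
      linarith
    have hc3 : ((K ∩ A (q + (m + 1))).card : ℝ) ≤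
        2 * e + ((K \ A (q + 1)) ∩ A (q + 1 + m)).card := by
      have : (K ∩ A (q + (m + 1))).card ≤
          2 * e + ((K \ A (q + 1)) ∩ A (q + 1 + m)).card := by omega
      exact_mod_cast this
    have hpow : (1 : ℝ) ≤ ρ ^ (m + 1) := one_le_pow₀ hρ1
    have he : (0 : ℝ) ≤ e := Nat.cast_nonneg _
    calc _ ≤ 2 * (e : ℝ) + 2 * m * ρ ^ m * e' := hc3.trans (by linarith)
      _ ≤ 2 * (ρ ^ (m + 1) * e) + 2 * m * ρ ^ m * (ρ * e) := by
          gcongr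
          exact le_mul_of_one_le_left he hpow
      _ = _ := by push_cast; ring

end Layers

/-! ### Deleting a residue class of levels -/

section Levels

variable {V : Type u} [Fintype V] {G : SimpleGraph V}

theorem IsLayering.exists_level {a s : ℕ} {A Z : ℕ → Finset V} (h : IsLayering G a s A Z) :
    ∃ level : V → ℕ, (∀ v j, v ∈ A j ↔ level v ≤ j) ∧
      ∀ u v, G.Adj u v → level v ≤ level u + 1 := by
  classical
  have hmem : ∀ v j, v ∈ A j ↔ Nat.find (h.exists_mem v) ≤ j := fun v j =>
    ⟨fun hv => Nat.find_min' _ hv, fun hj => h.mono hj (Nat.find_spec (h.exists_mem v))⟩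
  exact ⟨fun v => Nat.find (h.exists_mem v), hmem, fun u v huv =>
    (hmem v _).1 (h.mem_succ_of_adj ((hmem u _).2 le_rfl) huv)⟩

open Classical in
/-- Deleting the levels in a residue class modulo `a` leaves components of bounded order. -/
theorem IsLayering.card_component_le {a s Δ : ℕ} {A Z : ℕ → Finset V} (h : IsLayering G a s A Z)
    (ha : 1 ≤ a) (hs : 1 ≤ s) (hΔ2 : 2 ≤ Δ) (hΔ : ∀ v, (univ.filter (G.Adj v)).card ≤ Δ)
    {level : V → ℕ} (hlevel : ∀ v j, v ∈ A j ↔ level v ≤ j)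
    (hlip : ∀ u v, G.Adj u v → level v ≤ level u + 1) {i : ℕ} (hi : i < a) {x : V}
    (hx : level x % a ≠ i) :
    ((univ.filter fun v => (within G {v | level v % a ≠ i}).Reachable x v).card : ℝ) ≤
      1 + 2 * a * (((Δ : ℝ) - 1) * (1 + 2 / a)) ^ a * (s * Δ) := by
  have hfac : (0 : ℝ) ≤ 2 * a * (((Δ : ℝ) - 1) * (1 + 2 / a)) ^ a := by
    have : (2 : ℝ) ≤ Δ := by exact_mod_cast hΔ2
    have : (0 : ℝ) ≤ (Δ : ℝ) - 1 := by linarith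
    positivity
  set B : Set V := {v | level v % a ≠ i} with hB
  by_cases hxi : level x < i
  · -- the component stays below the first deleted level
    have hbelow : ∀ y, (within G B).Reachable x y → level y < i := fun y hy =>
      reachable_invariant hy (fun y => level y < i) (fun u v huv hu => by
        have h1 := hlip u v huv.1
        have h2 : level v % a ≠ i := huv.2.2
        -- The level rises by at most one from below `i`, so it is at most `i < a` and equals its
        -- own residue, which is not `i`.
        have h3 : level v < a := by omega
        rw [Nat.mod_eq_of_lt h3] at h2
        omega) hxi
    obtain ⟨p, ⟨hp, hxp⟩, hpu⟩ := h.seed x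
    let K := univ.filter fun v => v ∉ A 0 ∧ G.Reachable x v
    have hK : IsClosedOff G (A 0) K := by
      refine ⟨fun v hv => (mem_filter.1 hv).2.1, fun u hu v hv hadj => ?_⟩
      exact mem_filter.2 ⟨mem_univ _, hv, (mem_filter.1 hu).2.2.trans hadj.reachable⟩
    have hfr : (frontier G (A 0) ∩ K).card ≤ ({p} : Finset V).card * Δ :=
      card_frontier_inter_le hΔ fun v hv u hu hadj => mem_singleton.2
        (hpu u ⟨hu, (mem_filter.1 hv).2.2.trans hadj.reachable⟩)
    -- The seed `p` lies in `A 0`, outside `K`; it accounts for the summand `1` in the bound.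
    have hsub : (univ.filter fun v => (within G B).Reachable x v) ⊆ {p} ∪ (K ∩ A (0 + a)) := by
      intro v hv
      have hv' := (mem_filter.1 hv).2
      have hreach : G.Reachable x v := hv'.mono (show within G B ≤ G from fun _ _ h => h.1)
      rw [mem_union, mem_singleton, mem_inter, mem_filter]
      by_cases hv0 : v ∈ A 0
      · exact Or.inl (hpu v ⟨hv0, hreach⟩)
      · exact Or.inr ⟨⟨mem_univ _, hv0, hreach⟩, (hlevel v _).2 (by have := hbelow v hv'; omega)⟩
    have hcard := (card_le_card hsub).trans (card_union_le _ _)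
    rw [card_singleton] at hcard hfr
    have hg := h.card_inter_le ha hΔ2 hΔ a 0 K hK
    have hfr' : ((frontier G (A 0) ∩ K).card : ℝ) ≤ s * Δ := by
      have : 1 * Δ ≤ s * Δ := Nat.mul_le_mul_right _ hs
      exact_mod_cast hfr.trans this
    calc _ ≤ (1 : ℝ) + (K ∩ A (0 + a)).card := by exact_mod_cast hcard
      _ ≤ _ := by
        have := hg.trans (mul_le_mul_of_nonneg_left hfr' hfac)
        linarith
  · -- the component lies strictly between the consecutive deleted levels `q` and `q + a`
    obtain ⟨q, hqi, hqx, hxq⟩ : ∃ q, q % a = i ∧ q ≤ level x ∧ level x < q + a := by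
      -- The largest level up to `level x` that is congruent to `i`.
      refine ⟨level x - (level x - i) % a, ?_, Nat.sub_le _ _, ?_⟩
      · have h1 := Nat.div_add_mod (level x - i) a
        have : level x - (level x - i) % a = i + a * ((level x - i) / a) := by omega
        rw [this, Nat.add_mul_mod_self_left, Nat.mod_eq_of_lt hi]
      · have h1 := Nat.mod_lt (level x - i) ha
        have h2 := Nat.mod_le (level x - i) a
        omega
    have hq : ∀ v, level v % a ≠ i → level v ≠ q ∧ level v ≠ q + a := fun v hv =>
      ⟨fun hc => hv (by rw [hc, hqi]), fun hc => hv (by rw [hc, Nat.add_mod_right, hqi])⟩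
    have hxA : x ∉ A q := by
      have := hq x hx
      rw [hlevel]
      omega
    let K := univ.filter fun v => (within G (↑(A q))ᶜ).Reachable x v
    have hbetween : ∀ y, (within G B).Reachable x y →
        (within G (↑(A q))ᶜ).Reachable x y ∧ q < level y ∧ level y < q + a := fun y hy =>
      reachable_invariant hy (fun y => (within G (↑(A q))ᶜ).Reachable x y ∧
        q < level y ∧ level y < q + a) (fun u v huv hu => by
          have h1 := hlip u v huv.1
          have h2 := hlip v u huv.1.symm
          have h3 := hq v huv.2.2
          refine ⟨hu.1.trans (SimpleGraph.Adj.reachable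
            (show (within G (↑(A q))ᶜ).Adj u v from ⟨huv.1, ?_, ?_⟩)), by omega, by omega⟩
          · rw [Set.mem_compl_iff, mem_coe, hlevel]
            omega
          · rw [Set.mem_compl_iff, mem_coe, hlevel]
            omega) ⟨.refl _, by have := hq x hx; omega, hxq⟩
    have hKA : ∀ v ∈ K, v ∉ A q := fun v hv => by
      simpa using mem_of_within_reachable (mem_filter.1 hv).2 (by simpa using hxA)
    have hK : IsClosedOff G (A q) K := by
      refine ⟨hKA, fun u hu v hv hadj => mem_filter.2 ⟨mem_univ _, ?_⟩⟩
      exact (mem_filter.1 hu).2.trans (SimpleGraph.Adj.reachable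
        (show (within G (↑(A q))ᶜ).Adj u v from
          ⟨hadj, by simpa using hKA u hu, by simpa using hv⟩))
    have hfr := (card_frontier_inter_le hΔ (A := A q) (K := K)
      (N := attachment G (↑(A q))ᶜ (A q) x) fun v hv u hu hadj =>
        mem_attachment.2 ⟨hu, v, (mem_filter.1 hv).2, hadj⟩).trans
      (Nat.mul_le_mul_right _ (h.attachment_le hs q x hxA))
    have hsub : (univ.filter fun v => (within G B).Reachable x v) ⊆ K ∩ A (q + a) := by
      intro v hv
      obtain ⟨h1, h2, h3⟩ := hbetween v (mem_filter.1 hv).2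
      exact mem_inter.2 ⟨mem_filter.2 ⟨mem_univ _, h1⟩, (hlevel v _).2 h3.le⟩
    have hg := h.card_inter_le ha hΔ2 hΔ a q K hK
    have hfr' : ((frontier G (A q) ∩ K).card : ℝ) ≤ s * Δ := by exact_mod_cast hfr
    calc _ ≤ ((K ∩ A (q + a)).card : ℝ) := by exact_mod_cast card_le_card hsub
      _ ≤ _ := by
        have := hg.trans (mul_le_mul_of_nonneg_left hfr' hfac)
        linarith

open Classical in
theorem maxComponentOrder_induce_le (X : Set V) {b : ℝ} (hb : 0 ≤ b)
    (h : ∀ x ∉ X, ((univ.filter fun v => (within G Xᶜ).Reachable x v).card : ℝ) ≤ b) :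
    (maxComponentOrder (G.induce Xᶜ) : ℝ) ≤ b := by
  have key : maxComponentOrder (G.induce Xᶜ) ≤ ⌊b⌋₊ := by
    refine ciSup_le' fun c => ?_
    induction c using SimpleGraph.ConnectedComponent.ind with
    | _ x =>
    refine le_trans ?_ (Nat.le_floor (h x.1 x.2))
    rw [← Set.ncard_image_of_injective _ Subtype.val_injective, ← Set.ncard_coe_finset]
    refine Set.ncard_le_ncard ?_ (Set.toFinite _)
    rintro _ ⟨y, hy, rfl⟩
    have hxy : (G.induce Xᶜ).Reachable x y :=
      (SimpleGraph.ConnectedComponent.exact hy).symm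
    let f : G.induce Xᶜ →g within G Xᶜ := ⟨Subtype.val, fun {u v} huv => ⟨huv, u.2, v.2⟩⟩
    have := hxy.map f
    rw [mem_coe, mem_filter]
    exact ⟨mem_univ _, this⟩
  exact (Nat.cast_le.2 key).trans (Nat.floor_le hb)

theorem exists_treeDecomposition_of_treewidth_lt {k : ℕ} (h : treewidth G < k) :
    ∃ D : TreeDecomposition G, ∀ t, (D.bag t).card ≤ k := by
  obtain ⟨D, hD⟩ : ∃ D : TreeDecomposition G, D.width = treewidth G :=
    Nat.sInf_mem (s := {w | ∃ D : TreeDecomposition G, D.width = w})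
      ⟨_, TreeDecomposition.trivial G, rfl⟩
  refine ⟨D, fun t => ?_⟩
  have h1 : (D.bag t).card ≤ univ.sup fun t => (D.bag t).card :=
    le_sup (f := fun t => (D.bag t).card) (mem_univ t)
  have h2 : (univ.sup fun t => (D.bag t).card) - 1 < k := by
    rw [← hD] at h
    exact h
  -- Truncated subtraction is harmless: if all bags are empty, their sizes are at most `k` anyway.
  omega

end Levels

/-- The random set of vertices whose level lies in a uniformly random residue class. -/
theorem exists_pmf_of_level {V : Type u} {a : ℕ} (ha : 1 ≤ a) (level : V → ℕ) (F : Set (Set V))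
    (hF : ∀ i < a, {v | level v % a = i} ∈ F) :
    ∃ p : PMF (Set V), p.support ⊆ F ∧ IsThin p (1 / (a : ℝ)) := by
  classical
  have : NeZero a := ⟨by omega⟩
  refine ⟨PMF.uniformOfFintype (Fin a) |>.map fun i : Fin a => {v | level v % a = (i : ℕ)}, ?_, fun v => ?_⟩
  · intro Y hY
    obtain ⟨i, -, rfl⟩ := (PMF.mem_support_map_iff _ _ _).1 hY
    exact hF i i.2
  · rw [PMF.toOuterMeasure_map_apply, PMF.toOuterMeasure_uniformOfFintype_apply, Fintype.card_fin]
    -- The residue of `level v` is unique, so at most one of the `a` equally likely indices deletes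
    -- `v`.
    have hcard : Fintype.card
        ((fun i : Fin a => {v | level v % a = (i : ℕ)}) ⁻¹' {X : Set V | v ∈ X}) ≤ 1 := by
      rw [Fintype.card_le_one_iff]
      rintro ⟨i, hi⟩ ⟨j, hj⟩
      exact Subtype.ext (Fin.ext ((show level v % a = i from hi).symm.trans hj))
    rw [ENNReal.ofReal_div_of_pos (by exact_mod_cast ha), ENNReal.ofReal_one,
      ENNReal.ofReal_natCast]
    gcongr
    exact_mod_cast hcard

/-! ### Numerical estimates -/

theorem one_add_two_div_pow_le {a : ℕ} (ha : 1 ≤ a) : (1 + 2 / (a : ℝ)) ^ a ≤ 8 := by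
  have ha' : (0 : ℝ) < a := by exact_mod_cast ha
  calc (1 + 2 / (a : ℝ)) ^ a ≤ Real.exp (2 / a) ^ a := by
        gcongr
        linarith [Real.add_one_le_exp (2 / (a : ℝ))]
    _ = Real.exp 1 ^ 2 := by
        rw [← Real.exp_nat_mul, ← Real.exp_nat_mul]
        congr 1
        push_cast
        field_simp
    _ ≤ 8 := by nlinarith [Real.exp_one_lt_d9, Real.exp_pos 1]

/-- Bernoulli's inequality at exponent `√a`, squared. -/
theorem le_two_rpow_two_mul_sqrt {a : ℕ} (ha : 1 ≤ a) : (a : ℝ) ≤ 2 ^ (2 * √(a : ℝ)) := by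
  have h1 : √(a : ℝ) ≤ 2 ^ √(a : ℝ) := by
    have := one_add_mul_self_le_rpow_one_add (s := 1) (by norm_num)
      (Real.one_le_sqrt.2 (show (1 : ℝ) ≤ a by exact_mod_cast ha))
    norm_num at this
    linarith
  calc (a : ℝ) = √(a : ℝ) ^ 2 := (Real.sq_sqrt (Nat.cast_nonneg a)).symm
    _ ≤ ((2 : ℝ) ^ √(a : ℝ)) ^ 2 := by gcongr
    _ = _ := by
      rw [mul_comm, Real.rpow_mul (by norm_num)]
      norm_num

/-- With `d = Δ - 1`, the left side is at most `97 * k * d ^ a * a ^ 2 * d`, where `97 = 1 + 2 * 8 *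
3 * 2`. The exponent `12 * √a` is spent as `7` for `97 ≤ 2 ^ 7`, `2` for each factor `a`, and `1`
for `d`. -/
theorem component_bound_le {a k Δ : ℕ} (ha : 1 ≤ a) (hk : 1 ≤ k) (hΔ : 3 ≤ Δ) :
    1 + 2 * (a : ℝ) * (((Δ : ℝ) - 1) * (1 + 2 / a)) ^ a * (((a + 2) * k : ℕ) * Δ) ≤
      (k : ℝ) * ((Δ : ℝ) - 1) ^ ((a : ℝ) + 12 * √(a : ℝ)) := by
  have ha' : (1 : ℝ) ≤ a := by exact_mod_cast ha
  have hk' : (1 : ℝ) ≤ k := by exact_mod_cast hk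
  have hΔ' : (3 : ℝ) ≤ Δ := by exact_mod_cast hΔ
  obtain ⟨d, hd⟩ : ∃ d : ℝ, d = (Δ : ℝ) - 1 := ⟨_, rfl⟩
  have hd2 : 2 ≤ d := by linarith
  have hsqrt : 1 ≤ √(a : ℝ) := Real.one_le_sqrt.2 ha'
  have hpow : 1 ≤ d ^ a := one_le_pow₀ (by linarith)
  have hle : ∀ x : ℝ, 0 ≤ x → (2 : ℝ) ^ x ≤ d ^ x := fun x hx =>
    Real.rpow_le_rpow (by norm_num) hd2 hx
  have h97 : (97 : ℝ) ≤ d ^ (7 * √(a : ℝ)) :=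
    calc (97 : ℝ) ≤ (2 : ℝ) ^ (7 : ℝ) := by norm_num
      _ ≤ 2 ^ (7 * √(a : ℝ)) := Real.rpow_le_rpow_of_exponent_le (by norm_num) (by linarith)
      _ ≤ _ := hle _ (by positivity)
  have hd1 : d ≤ d ^ √(a : ℝ) := by
    conv_lhs => rw [← Real.rpow_one d]
    exact Real.rpow_le_rpow_of_exponent_le (by linarith) hsqrt
  have haa : (a : ℝ) ≤ d ^ (2 * √(a : ℝ)) :=
    (le_two_rpow_two_mul_sqrt ha).trans (hle _ (by positivity))
  have h8 := one_add_two_div_pow_le ha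
  have hsplit : d ^ ((a : ℝ) + 12 * √(a : ℝ)) =
      d ^ a * d ^ (7 * √(a : ℝ)) * (d ^ (2 * √(a : ℝ)) * d ^ (2 * √(a : ℝ))) * d ^ √(a : ℝ) := by
    have h0 : 0 < d := by linarith
    rw [← Real.rpow_natCast d a, ← Real.rpow_add h0, ← Real.rpow_add h0, ← Real.rpow_add h0,
      ← Real.rpow_add h0]
    congr 1
    ring
  have hΔd : (Δ : ℝ) = d + 1 := by linarith
  rw [← hd, hsplit, hΔd, mul_pow]
  push_cast
  calc 1 + 2 * (a : ℝ) * (d ^ a * (1 + 2 / a) ^ a) * ((a + 2) * k * (d + 1))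
      ≤ k * d ^ a * a * a * d + 2 * (a : ℝ) * (d ^ a * 8) * ((a + 2 * a) * k * (2 * d)) := by
        have h1 : 1 ≤ k * d ^ a * a * a * d := by
          have := one_le_mul_of_one_le_of_one_le hk' hpow
          have := one_le_mul_of_one_le_of_one_le this ha'
          have := one_le_mul_of_one_le_of_one_le this ha'
          exact one_le_mul_of_one_le_of_one_le this (by linarith)
        gcongr <;> linarith
    _ = k * (d ^ a * 97 * (a * a) * d) := by ring
    _ ≤ _ := by gcongr

end FracFragile

theorem mainTheorem6 :
    ∃ C : ℝ, 0 ≤ C ∧ ∀ k Δ : ℕ, 1 ≤ k → 3 ≤ Δ →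
      (FracFragile.boundedTreewidthDegree.{u} k Δ).FractionallyFragileAtRate FracFragile.star
        (fun a : ℕ => (k : ℝ) * ((Δ : ℝ) - 1) ^ ((a : ℝ) + C * Real.sqrt (a : ℝ))) := by
  classical
  refine ⟨12, by norm_num, fun k Δ hk hΔ => ⟨⟨fun a => ?_, fun a b hab => ?_⟩, ?_⟩⟩
  · have : (3 : ℝ) ≤ Δ := by exact_mod_cast hΔ
    have : (0 : ℝ) ≤ (Δ : ℝ) - 1 := by linarith
    positivity
  · have : (3 : ℝ) ≤ Δ := by exact_mod_cast hΔ
    refine mul_le_mul_of_nonneg_left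
      (Real.rpow_le_rpow_of_exponent_le (by linarith) ?_) (Nat.cast_nonneg k)
    have : (a : ℝ) ≤ b := by exact_mod_cast hab
    gcongr
  · rintro V _ G ⟨htw, hdeg⟩ a ha
    obtain ⟨D, hD⟩ := FracFragile.exists_treeDecomposition_of_treewidth_lt htw
    obtain ⟨A, Z, hA⟩ := D.exists_isLayering hk ha hD
    obtain ⟨level, hlevel, hlip⟩ := hA.exists_level
    refine FracFragile.exists_pmf_of_level ha level _ fun i hi => ?_
    have hdeg' : ∀ v, (Finset.univ.filter (G.Adj v)).card ≤ Δ := fun v => by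
      refine le_trans ?_ hdeg
      rw [← SimpleGraph.neighborFinset_eq_filter]
      exact G.degree_le_maxDegree v
    have hb := FracFragile.component_bound_le ha hk hΔ
    refine FracFragile.maxComponentOrder_induce_le _ ?_ fun x hx => ?_
    · have : (3 : ℝ) ≤ Δ := by exact_mod_cast hΔ
      have : (0 : ℝ) ≤ (Δ : ℝ) - 1 := by linarith
      positivity
    · exact (hA.card_component_le ha (Nat.mul_pos (by omega) hk) (by omega) hdeg' hlevel hlip hi
        hx).trans hb
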